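/- Let $\Gamma$ be an amenable group with a finite generating set $S$, let $d_W$ be the left-invariant word metric on $\Gamma$ induced by $S\cup S^{-1}$, and let $e$ be the identity of $\Gamma$. Suppose that there are a central element $v\in Z(\Gamma)$, a real number $\rho>1$ and constants $c_1,c_2>0$ such that \[ c_1k^{1/\rho}\le d_W(v^k,e)\le c_2k^{1/\rho}\qquad\text{for all integers } k\ge 1. \] Then there is a constant $C\in(0,\infty)$, depending only on $\Gamma,S,v,\rho$, such that the following holds. Let $q\in[2,\infty)$, and let $(X,\|\cdot\|_X)$ be a real Banach space that is $q$-uniformly convex, i.e. for which \[ K_q(X):=\inf\left\{K>0:\ \forall x,y\in X\ \left(\|x\|_X^q+\frac{1}{K^q}\|y\|_X^q\right)^{1/q}\le\left(\frac{\|x+y\|_X^q+\|x-y\|_X^q}{2}\right)^{1/q}\right\} \] is finite. Let $f:\Gamma\to X$ be $1$-Lipschitz with respect to $d_W$, and let $\omega_f:(0,\infty)\to[0,\infty)$ be its compression function, i.e. the largest nondecreasing function such that $\|f(x)-f(y)\|_X\ge\omega_f(d_W(x,y))$ for all distinct $x,y\in\Gamma$. Then for every real $t\ge 3$ there is an integer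 $n$ with $t\le n\le t^2$ and \[ \frac{\omega_f(n)}{n}\le C\,K_q(X)\left(\frac{\log\log n}{\log n}\right)^{1/q}. \] -/

import Mathlib

noncomputable section

/-- `m` is a left-invariant mean on the space of bounded real functions on the group `Γ`: a
normalized positive left-invariant linear functional.  (Only the values of `m` at bounded functions
are constrained; its values at unbounded functions are irrelevant.) -/
structure IsLeftInvariantMean {Γ : Type*} [Group Γ] (m : (Γ → ℝ) → ℝ) : Prop where
  map_add : ∀ φ ψ : Γ → ℝ, (∃ B, ∀ x, |φ x| ≤ B) → (∃ B, ∀ x, |ψ x| ≤ B) →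
    m (fun x => φ x + ψ x) = m φ + m ψ
  map_smul : ∀ (c : ℝ) (φ : Γ → ℝ), (∃ B, ∀ x, |φ x| ≤ B) → m (fun x => c * φ x) = c * m φ
  map_nonneg : ∀ φ : Γ → ℝ, (∃ B, ∀ x, |φ x| ≤ B) → (∀ x, 0 ≤ φ x) → 0 ≤ m φ
  map_one : m (fun _ => 1) = 1
  map_translate : ∀ (g : Γ) (φ : Γ → ℝ), (∃ B, ∀ x, |φ x| ≤ B) → m (fun x => φ (g * x)) = m φ

/-- A (discrete) group is amenable if it carries a left-invariant mean. -/
def IsAmenableGroup (Γ : Type*) [Group Γ] : Prop :=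
  ∃ m : (Γ → ℝ) → ℝ, IsLeftInvariantMean m

/-- The word length of `g` with respect to `S`: the least length of a word in the letters
`S ∪ S⁻¹` that represents `g`. -/
def wordLength {Γ : Type*} [Group Γ] (S : Set Γ) (g : Γ) : ℕ :=
  sInf {n : ℕ | ∃ l : List Γ, l.length = n ∧ (∀ a ∈ l, a ∈ S ∨ a⁻¹ ∈ S) ∧ l.prod = g}

/-- The left-invariant word metric `d_W` induced by `S`. -/
def wordDist {Γ : Type*} [Group Γ] (S : Set Γ) (x y : Γ) : ℝ :=
  (wordLength S (x⁻¹ * y) : ℝ)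

/-- The positive constants `K` that are admissible in the `q`-uniform convexity inequality
of `X`. -/
def uniformConvexityConstants (q : ℝ) (X : Type*) [NormedAddCommGroup X] : Set ℝ :=
  {K : ℝ | 0 < K ∧ ∀ x y : X,
    (‖x‖ ^ q + 1 / K ^ q * ‖y‖ ^ q) ^ (1 / q) ≤
      ((‖x + y‖ ^ q + ‖x - y‖ ^ q) / 2) ^ (1 / q)}

/-- The `q`-uniform convexity constant `K_q(X)`, the infimum of the admissible constants.  It is
meaningful if `X` is `q`-uniformly convex (otherwise the infimum over the empty set should be read
as `∞`). -/
def uniformConvexityConst (q : ℝ) (X : Type*) [NormedAddCommGroup X] : ℝ :=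
  sInf (uniformConvexityConstants q X)

/-- `X` is `q`-uniformly convex, `q ∈ [2, ∞)`, if `K_q(X) < ∞`, that is, if some finite constant is
admissible. -/
def IsQUniformlyConvex (q : ℝ) (X : Type*) [NormedAddCommGroup X] : Prop :=
  2 ≤ q ∧ (uniformConvexityConstants q X).Nonempty

/-- `ω : (0, ∞) → [0, ∞)` is nondecreasing and `‖f x - f y‖ ≥ ω (d x y)` whenever `d x y > 0`.
Only the restriction of `ω` to `(0, ∞)` matters. -/
structure IsCompressionBound {M X : Type*} [NormedAddCommGroup X] (d : M → M → ℝ) (f : M → X)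
    (ω : ℝ → ℝ) : Prop where
  monotoneOn : MonotoneOn ω (Set.Ioi 0)
  nonneg : ∀ s, 0 < s → 0 ≤ ω s
  le_norm : ∀ x y, 0 < d x y → ω (d x y) ≤ ‖f x - f y‖

/-- The compression function `ω_f` of `f : (M, d) → X`: the largest nondecreasing function
`ω : (0, ∞) → [0, ∞)` with `‖f x - f y‖ ≥ ω (d x y)` for all `x, y`, i.e. the pointwise supremum of
all such functions. -/
def compressionFunction {M X : Type*} [NormedAddCommGroup X] (d : M → M → ℝ) (f : M → X)
    (s : ℝ) : ℝ :=
  sSup {r : ℝ | ∃ ω : ℝ → ℝ, IsCompressionBound d f ω ∧ r = ω s}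

/-- On an unbounded space, `compressionFunction d f` is indeed the largest compression bound. -/
theorem compressionFunction_isLargest {M X : Type*} [NormedAddCommGroup X] (d : M → M → ℝ)
    (f : M → X) (hd : ∀ r : ℝ, ∃ x y, r ≤ d x y) :
    IsCompressionBound d f (compressionFunction d f) ∧
      ∀ ω, IsCompressionBound d f ω → ∀ s, 0 < s → ω s ≤ compressionFunction d f s := by
  have hbdd : ∀ s : ℝ, 0 < s →
      BddAbove {r : ℝ | ∃ ω : ℝ → ℝ, IsCompressionBound d f ω ∧ r = ω s} := by
    intro s hs
    obtain ⟨x, y, hxy⟩ := hd s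
    refine ⟨‖f x - f y‖, ?_⟩
    rintro r ⟨ω, hω, rfl⟩
    have hpos : 0 < d x y := lt_of_lt_of_le hs hxy
    exact (hω.monotoneOn hs hpos hxy).trans (hω.le_norm x y hpos)
  have hzero : IsCompressionBound d f (fun _ => (0 : ℝ)) :=
    ⟨fun _ _ _ _ _ => le_rfl, fun _ _ => le_rfl, fun _ _ _ => norm_nonneg _⟩
  have hle : ∀ ω, IsCompressionBound d f ω → ∀ s, 0 < s → ω s ≤ compressionFunction d f s :=
    fun ω hω s hs => le_csSup (hbdd s hs) ⟨ω, hω, rfl⟩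
  refine ⟨⟨?_, ?_, ?_⟩, hle⟩
  · intro a ha b hb hab
    refine csSup_le ⟨0, _, hzero, rfl⟩ ?_
    rintro r ⟨ω, hω, rfl⟩
    exact (hω.monotoneOn ha hb hab).trans (hle ω hω b hb)
  · intro s hs
    exact hle _ hzero s hs
  · intro x y hxy
    refine csSup_le ⟨0, _, hzero, rfl⟩ ?_
    rintro r ⟨ω, hω, rfl⟩
    exact hω.le_norm x y hxy

end

/-! The proof is a multiscale energy argument along the orbit of `v`. Distortion places `v ^ k` at
distance of order `k ^ (1 / ρ)`, so a Lipschitz map averaged over `N` orbit points changes only on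
the order of `N ^ (1 / ρ)`, while the average has speed at most of order `N ^ (1 / ρ - 1)` in the
direction `v`. Since `v` is central, averaging commutes with the increments `f (x * a) - f x`. These
are bounded even though `f` need not be, so an invariant mean of their `q`-th powers (the energy)
makes sense.

Replace `f` by the midpoint of itself and its orbit average, at scales `N j = B * a ^ (2 * j)`.
Uniform convexity makes each step lower the energy by at least `(2 * K) ^ (-q)` times the energy of
the difference `g - h` between the current map `g` and its average `h`
(`rightMean_lazy_orbitAvg_add_le`). The energy starts at most `1` per generator, so among `J` scales
one has difference energy `O(K ^ q / J)` (`exists_scale_energy_le`).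

At that scale take `k` between `N j` and `N (j + 1)`. Then `f` is close to `g`, `h` hardly moves
under `v ^ k`, and the small energy of `g - h`, summed along a geodesic word, limits its
displacement. Hence `f` compresses `v ^ k` (`exists_scale_compressed`). With `a` a power of about
`log t` and `J` about `log t / log log t`, all scales fit between `t` and `t ^ 2`. -/

open Finset

/-! ### Bounded functions -/

/-- Bounded real functions. -/
def IsBddFun {α : Type*} (φ : α → ℝ) : Prop := ∃ B, ∀ x, |φ x| ≤ B

namespace IsBddFun

variable {α : Type*} {φ ψ : α → ℝ}

theorem add (hφ : IsBddFun φ) (hψ : IsBddFun ψ) : IsBddFun (fun x => φ x + ψ x) := by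
  obtain ⟨B, hB⟩ := hφ
  obtain ⟨B', hB'⟩ := hψ
  exact ⟨B + B', fun x => (abs_add_le _ _).trans (add_le_add (hB x) (hB' x))⟩

theorem const_mul (c : ℝ) (hφ : IsBddFun φ) : IsBddFun (fun x => c * φ x) := by
  obtain ⟨B, hB⟩ := hφ
  exact ⟨|c| * B, fun x => by
    rw [abs_mul]; exact mul_le_mul_of_nonneg_left (hB x) (abs_nonneg c)⟩

theorem const (c : ℝ) : IsBddFun (fun _ : α => c) := ⟨|c|, fun _ => le_rfl⟩

theorem sum {ι : Type*} (s : Finset ι) {φ : ι → α → ℝ} (h : ∀ i ∈ s, IsBddFun (φ i)) :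
    IsBddFun (fun x => ∑ i ∈ s, φ i x) := by
  classical
  induction s using Finset.induction_on with
  | empty => simpa using const (α := α) 0
  | insert a s ha ih =>
    simp only [Finset.sum_insert ha]
    exact (h a (by simp)).add (ih fun i hi => h i (by simp [hi]))

theorem comp {β : Type*} (hφ : IsBddFun φ) (e : β → α) : IsBddFun (fun x => φ (e x)) := by
  obtain ⟨B, hB⟩ := hφ
  exact ⟨B, fun x => hB _⟩

theorem norm_rpow {E : Type*} [NormedAddCommGroup E] {u : α → E} {B q : ℝ} (hq : 0 ≤ q)
    (hu : ∀ x, ‖u x‖ ≤ B) : IsBddFun (fun x => ‖u x‖ ^ q) := by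
  refine ⟨B ^ q, fun x => ?_⟩
  rw [abs_of_nonneg (by positivity)]
  exact Real.rpow_le_rpow (norm_nonneg _) (hu x) hq

end IsBddFun

/-! ### Right-invariant means -/

section Mean

variable {Γ : Type*} [Group Γ] {m : (Γ → ℝ) → ℝ}

/-- The functional obtained from `m` by inversion on the group; it is right-invariant if `m` is
left-invariant. -/
def rightMean (m : (Γ → ℝ) → ℝ) (φ : Γ → ℝ) : ℝ := m (fun x => φ x⁻¹)

namespace IsLeftInvariantMean

theorem rightMean_add (hm : IsLeftInvariantMean m) {φ ψ : Γ → ℝ} (hφ : IsBddFun φ)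
    (hψ : IsBddFun ψ) : rightMean m (fun x => φ x + ψ x) = rightMean m φ + rightMean m ψ :=
  hm.map_add _ _ (hφ.comp _) (hψ.comp _)

theorem rightMean_const_mul (hm : IsLeftInvariantMean m) (c : ℝ) {φ : Γ → ℝ} (hφ : IsBddFun φ) :
    rightMean m (fun x => c * φ x) = c * rightMean m φ :=
  hm.map_smul _ _ (hφ.comp _)

theorem rightMean_nonneg (hm : IsLeftInvariantMean m) {φ : Γ → ℝ} (hφ : IsBddFun φ)
    (h : ∀ x, 0 ≤ φ x) : 0 ≤ rightMean m φ :=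
  hm.map_nonneg _ (hφ.comp _) fun _ => h _

theorem rightMean_const (hm : IsLeftInvariantMean m) (c : ℝ) :
    rightMean m (fun _ => c) = c := by
  have := hm.rightMean_const_mul c (IsBddFun.const (α := Γ) 1)
  rw [mul_one] at this
  rw [this, rightMean, hm.map_one, mul_one]

theorem rightMean_mono (hm : IsLeftInvariantMean m) {φ ψ : Γ → ℝ} (hφ : IsBddFun φ)
    (hψ : IsBddFun ψ) (h : ∀ x, φ x ≤ ψ x) : rightMean m φ ≤ rightMean m ψ := by
  have h0 := hm.rightMean_nonneg (hψ.add (hφ.const_mul (-1))) fun x => by linarith [h x]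
  rw [hm.rightMean_add hψ (hφ.const_mul _), hm.rightMean_const_mul _ hφ] at h0
  linarith

theorem rightMean_sum (hm : IsLeftInvariantMean m) {ι : Type*} (s : Finset ι) {φ : ι → Γ → ℝ}
    (h : ∀ i ∈ s, IsBddFun (φ i)) :
    rightMean m (fun x => ∑ i ∈ s, φ i x) = ∑ i ∈ s, rightMean m (φ i) := by
  classical
  induction s using Finset.induction_on with
  | empty => simpa using hm.rightMean_const 0
  | insert a s ha ih =>
    simp only [Finset.sum_insert ha]
    rw [hm.rightMean_add (h a (by simp)) (IsBddFun.sum s fun i hi => h i (by simp [hi])),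
      ih fun i hi => h i (by simp [hi])]

theorem rightMean_translate (hm : IsLeftInvariantMean m) (g : Γ) {φ : Γ → ℝ} (hφ : IsBddFun φ) :
    rightMean m (fun x => φ (x * g)) = rightMean m φ := by
  have := hm.map_translate g⁻¹ (fun x => φ x⁻¹) (hφ.comp _)
  simpa [rightMean] using this

end IsLeftInvariantMean

end Mean

/-! ### Smoothing along the orbit of a central element -/

section Smoothing

variable {Γ X : Type*} [Group Γ] [NormedAddCommGroup X] [NormedSpace ℝ X]

/-- The average of `F` along the first `n` points of the right orbit of `v`. -/
noncomputable def orbitAvg (v : Γ) (n : ℕ) (F : Γ → X) (x : Γ) : X :=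
  (n : ℝ)⁻¹ • ∑ i ∈ range n, F (x * v ^ i)

/-- The right increment of `F` in the direction `g`. -/
def rightIncr (g : Γ) (F : Γ → X) (x : Γ) : X := F (x * g) - F x

/-- Successive lazy orbit averages of `f` along the lengths `N 1, N 2, …`. -/
noncomputable def smoothing (v : Γ) (N : ℕ → ℕ) (f : Γ → X) : ℕ → Γ → X
  | 0 => f
  | j + 1 => fun x =>
      (1 / 2 : ℝ) • (smoothing v N f j x + orbitAvg v (N (j + 1)) (smoothing v N f j) x)

/-- This is where centrality enters: `g` moves past `v ^ i`, so energies of averaged maps become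
energies of averaged increments. -/
theorem rightIncr_orbitAvg {v : Γ} (hv : v ∈ Subgroup.center Γ) (n : ℕ) (F : Γ → X) (g x : Γ) :
    rightIncr g (orbitAvg v n F) x = orbitAvg v n (rightIncr g F) x := by
  have h : ∀ i : ℕ, x * g * v ^ i = x * v ^ i * g := fun i => by
    have := Subgroup.mem_center_iff.1 (Subgroup.pow_mem _ hv i) g
    rw [mul_assoc, this, mul_assoc]
  simp only [rightIncr, orbitAvg, ← smul_sub, ← Finset.sum_sub_distrib, h]

theorem rightIncr_smoothing_succ {v : Γ} (hv : v ∈ Subgroup.center Γ) (N : ℕ → ℕ) (f : Γ → X)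
    (j : ℕ) (g x : Γ) :
    rightIncr g (smoothing v N f (j + 1)) x = (1 / 2 : ℝ) • (rightIncr g (smoothing v N f j) x +
      orbitAvg v (N (j + 1)) (rightIncr g (smoothing v N f j)) x) := by
  rw [← rightIncr_orbitAvg hv]
  simp only [rightIncr, smoothing, ← smul_sub]
  congr 1
  abel

theorem norm_orbitAvg_le (v : Γ) (n : ℕ) (F : Γ → X) (x : Γ) {B : ℝ} (hB : 0 ≤ B)
    (hF : ∀ i < n, ‖F (x * v ^ i)‖ ≤ B) : ‖orbitAvg v n F x‖ ≤ B := by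
  rcases Nat.eq_zero_or_pos n with rfl | hn
  · simpa [orbitAvg] using hB
  have hn' : (0 : ℝ) < n := by exact_mod_cast hn
  rw [orbitAvg, norm_smul, Real.norm_of_nonneg (by positivity), inv_mul_le_iff₀ hn']
  refine (norm_sum_le_of_le _ fun i hi => hF i (by simpa using hi)).trans ?_
  simp

/-- Increments of the smoothed map are convex combinations of translated increments of `f`, so no
Lipschitz bound deteriorates. -/
theorem norm_rightIncr_smoothing_le {v : Γ} (hv : v ∈ Subgroup.center Γ) (N : ℕ → ℕ) {f : Γ → X}
    {g : Γ} {B : ℝ} (hf : ∀ x, ‖rightIncr g f x‖ ≤ B) (j : ℕ) (x : Γ) :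
    ‖rightIncr g (smoothing v N f j) x‖ ≤ B := by
  have hB : 0 ≤ B := (norm_nonneg _).trans (hf 1)
  induction j generalizing x with
  | zero => exact hf x
  | succ j ih =>
    rw [rightIncr_smoothing_succ hv, norm_smul, Real.norm_of_nonneg (by norm_num)]
    have h1 := norm_orbitAvg_le v (N (j + 1)) (rightIncr g (smoothing v N f j)) x hB
      fun i _ => ih _
    have h2 := ih x
    have h3 := norm_add_le (rightIncr g (smoothing v N f j) x)
      (orbitAvg v (N (j + 1)) (rightIncr g (smoothing v N f j)) x)
    linarith

theorem norm_orbitAvg_sub_le (v : Γ) {n : ℕ} (hn : 0 < n) (F : Γ → X) (x : Γ) {B : ℝ}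
    (hF : ∀ i < n, ‖rightIncr (v ^ i) F x‖ ≤ B) : ‖orbitAvg v n F x - F x‖ ≤ B := by
  have hn' : (n : ℝ) ≠ 0 := by exact_mod_cast hn.ne'
  have h : orbitAvg v n F x - F x = (n : ℝ)⁻¹ • ∑ i ∈ range n, rightIncr (v ^ i) F x := by
    simp only [rightIncr, Finset.sum_sub_distrib, smul_sub, orbitAvg, sum_const, card_range]
    rw [← Nat.cast_smul_eq_nsmul ℝ, smul_smul, inv_mul_cancel₀ hn', one_smul]
  have hn0 : (0 : ℝ) < n := by exact_mod_cast hn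
  rw [h, norm_smul, Real.norm_of_nonneg (by positivity), inv_mul_le_iff₀ hn0]
  refine (norm_sum_le_of_le _ fun i hi => hF i (by simpa using hi)).trans ?_
  simp

/-- Smoothing moves `f` by at most the order of the displacement at the last scale. -/
theorem norm_smoothing_sub_le {v : Γ} (hv : v ∈ Subgroup.center Γ) {N : ℕ → ℕ} {f : Γ → X}
    {δ : ℕ → ℝ} (hN : ∀ j, 0 < N j) (h0 : ∀ j, 0 ≤ δ j) (hδ : ∀ j, 2 * δ j ≤ δ (j + 1))
    (hf : ∀ j, ∀ i < N j, ∀ x, ‖rightIncr (v ^ i) f x‖ ≤ δ j) (j : ℕ) (x : Γ) :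
    ‖smoothing v N f j x - f x‖ ≤ δ j := by
  induction j with
  | zero => simpa [smoothing] using h0 0
  | succ j ih =>
    have h1 := norm_orbitAvg_sub_le v (hN (j + 1)) (smoothing v N f j) x
      fun i hi => norm_rightIncr_smoothing_le hv N (hf (j + 1) i hi) j x
    have h2 : smoothing v N f (j + 1) x - f x = (smoothing v N f j x - f x) +
        (1 / 2 : ℝ) • (orbitAvg v (N (j + 1)) (smoothing v N f j) x - smoothing v N f j x) := by
      simp only [smoothing]
      module
    have h3 : ‖(1 / 2 : ℝ) •
        (orbitAvg v (N (j + 1)) (smoothing v N f j) x - smoothing v N f j x)‖ ≤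
        1 / 2 * δ (j + 1) := by
      rw [norm_smul, Real.norm_of_nonneg (by norm_num)]
      linarith
    rw [h2]
    -- The doubling of `δ` closes the induction: `δ j + δ (j + 1) / 2 ≤ δ (j + 1)`, so earlier
    -- displacements do not accumulate.
    linarith [norm_add_le (smoothing v N f j x - f x) ((1 / 2 : ℝ) •
        (orbitAvg v (N (j + 1)) (smoothing v N f j) x - smoothing v N f j x)), hδ j]

/-- An orbit average over `n` points moves slowly in the direction `v`. -/
theorem norm_rightIncr_pow_orbitAvg_le {v : Γ} {n : ℕ} {F : Γ → X} {B : ℝ}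
    (hF : ∀ x, ‖rightIncr (v ^ n) F x‖ ≤ B) (k : ℕ) (x : Γ) :
    ‖rightIncr (v ^ k) (orbitAvg v n F) x‖ ≤ k * (B / n) := by
  -- Shifting the orbit segment by `v` changes only its two endpoints.
  have h1 : ∀ x, rightIncr v (orbitAvg v n F) x = (n : ℝ)⁻¹ • rightIncr (v ^ n) F x := by
    intro x
    simp only [rightIncr, orbitAvg, ← smul_sub]
    congr 1
    have := Finset.sum_range_sub (fun i => F (x * v ^ i)) n
    rw [Finset.sum_sub_distrib] at this
    simpa [mul_assoc, ← pow_succ'] using this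
  have h2 : ∀ x, ‖rightIncr v (orbitAvg v n F) x‖ ≤ B / n := fun x => by
    rw [h1, norm_smul, norm_inv, Real.norm_natCast, inv_mul_eq_div]
    gcongr
    exact hF x
  have h3 : rightIncr (v ^ k) (orbitAvg v n F) x =
      ∑ i ∈ range k, rightIncr v (orbitAvg v n F) (x * v ^ i) := by
    have := Finset.sum_range_sub (fun i => orbitAvg v n F (x * v ^ i)) k
    simpa [rightIncr, mul_assoc, ← pow_succ] using this.symm
  rw [h3]
  refine (norm_sum_le_of_le _ fun i _ => h2 _).trans ?_
  simp

end Smoothing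

/-! ### Energy along words -/

/-- The `q`-energy of the increments of `F` is controlled along words. -/
theorem IsLeftInvariantMean.rightMean_norm_rightIncr_prod_rpow_le
    {Γ X : Type*} [Group Γ] [NormedAddCommGroup X] {m : (Γ → ℝ) → ℝ} (hm : IsLeftInvariantMean m)
    {q E : ℝ} (hq : 1 ≤ q) {F : Γ → X} {A : Set Γ} (hb : ∀ a ∈ A, ∃ B, ∀ x, ‖rightIncr a F x‖ ≤ B)
    (hE : ∀ a ∈ A, rightMean m (fun x => ‖rightIncr a F x‖ ^ q) ≤ E)
    (l : List Γ) (hl : ∀ a ∈ l, a ∈ A) {r : ℝ} (hr : 0 ≤ r)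
    (h : ∀ x, r ≤ ‖rightIncr l.prod F x‖) :
    r ^ q ≤ (l.length : ℝ) ^ q * E := by
  have hq0 : 0 ≤ q := by linarith
  set n := l.length with hn
  rcases Nat.eq_zero_or_pos n with h0 | hpos
  · have hl0 : l = [] := List.length_eq_zero_iff.1 (hn ▸ h0)
    have := h 1
    simp only [hl0, List.prod_nil, rightIncr, mul_one, sub_self, norm_zero] at this
    rw [h0, le_antisymm this hr, Nat.cast_zero, Real.zero_rpow (by linarith), zero_mul]
  have hn' : (0 : ℝ) < n := by exact_mod_cast hpos
  let p : ℕ → Γ := fun i => (l.take i).prod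
  let a : ℕ → Γ := fun i => l.getD i 1
  have ha : ∀ i ∈ range n, a i ∈ A := fun i hi => by
    have hi' : i < l.length := by simpa using hi
    have : a i = l[i] := by simp [a, hi']
    rw [this]
    exact hl _ (List.getElem_mem hi')
  have hp : ∀ i ∈ range n, p (i + 1) = p i * a i := fun i hi => by
    have hi' : i < l.length := by simpa using hi
    have : a i = l[i] := by simp [a, hi']
    simp only [p]
    rw [this, List.prod_take_succ _ _ hi']
  have htel : ∀ x, rightIncr l.prod F x = ∑ i ∈ range n, rightIncr (a i) F (x * p i) := fun x => by
    have h1 := Finset.sum_range_sub (fun i => F (x * p i)) n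
    have h2 : p n = l.prod := by simp [p, hn]
    have h3 : p 0 = 1 := by simp [p]
    rw [h2, h3, mul_one] at h1
    rw [rightIncr, ← h1]
    refine Finset.sum_congr rfl fun i hi => ?_
    rw [hp i hi, rightIncr, mul_assoc]
  -- Power mean inequality for the telescoping sum; once the mean is taken, right invariance removes
  -- the prefixes `p i`.
  have hpt : ∀ x, r ^ q ≤ (n : ℝ) ^ (q - 1) * ∑ i ∈ range n, ‖rightIncr (a i) F (x * p i)‖ ^ q :=
      fun x => by
    have h1 : r ≤ ∑ i ∈ range n, |‖rightIncr (a i) F (x * p i)‖| := by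
      simp only [abs_norm]
      refine (h x).trans ?_
      rw [htel]
      exact norm_sum_le _ _
    have h2 := Real.rpow_sum_le_const_mul_sum_rpow (range n)
      (fun i => ‖rightIncr (a i) F (x * p i)‖) hq
    simp only [abs_norm, card_range] at h1 h2
    exact (Real.rpow_le_rpow hr h1 hq0).trans h2
  have hbd : ∀ i ∈ range n, IsBddFun fun x => ‖rightIncr (a i) F x‖ ^ q := fun i hi => by
    obtain ⟨B, hB⟩ := hb _ (ha i hi)
    exact IsBddFun.norm_rpow hq0 hB
  have hbd' : ∀ i ∈ range n, IsBddFun fun x => ‖rightIncr (a i) F (x * p i)‖ ^ q :=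
    fun i hi => (hbd i hi).comp (· * p i)
  have hfin := hm.rightMean_mono (IsBddFun.const _) ((IsBddFun.sum _ hbd').const_mul _) hpt
  rw [hm.rightMean_const, hm.rightMean_const_mul _ (IsBddFun.sum _ hbd'),
    hm.rightMean_sum _ hbd'] at hfin
  refine hfin.trans ?_
  have hs : ∑ i ∈ range n, rightMean m (fun x => ‖rightIncr (a i) F (x * p i)‖ ^ q) ≤ n * E := by
    refine (Finset.sum_le_sum fun i hi => ?_ : _ ≤ ∑ i ∈ range n, E).trans (by simp)
    rw [hm.rightMean_translate (p i) (hbd i hi)]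
    exact hE _ (ha i hi)
  calc (n : ℝ) ^ (q - 1) * _ ≤ (n : ℝ) ^ (q - 1) * (n * E) := by gcongr
    _ = (n : ℝ) ^ q * E := by
      rw [Real.rpow_sub_one hn'.ne']
      field_simp

/-! ### Energy decrease from uniform convexity -/

section Energy

variable {Γ X : Type*} [Group Γ] [NormedAddCommGroup X] [NormedSpace ℝ X] {m : (Γ → ℝ) → ℝ}

/-- Jensen's inequality pointwise, then right invariance of the mean. -/
theorem IsLeftInvariantMean.rightMean_norm_orbitAvg_rpow_le (hm : IsLeftInvariantMean m) {q : ℝ}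
    (hq : 1 ≤ q) (v : Γ) {n : ℕ} (hn : 0 < n) {u : Γ → X} {B : ℝ} (hu : ∀ x, ‖u x‖ ≤ B) :
    rightMean m (fun x => ‖orbitAvg v n u x‖ ^ q) ≤ rightMean m (fun x => ‖u x‖ ^ q) := by
  have hq0 : 0 ≤ q := by linarith
  have hB : 0 ≤ B := (norm_nonneg _).trans (hu 1)
  have hn' : (0 : ℝ) < n := by exact_mod_cast hn
  have hb := IsBddFun.norm_rpow hq0 hu
  have hpt : ∀ x, ‖orbitAvg v n u x‖ ^ q ≤
      ∑ i ∈ range n, (n : ℝ)⁻¹ * ‖u (x * v ^ i)‖ ^ q := fun x => by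
    have h1 : ‖orbitAvg v n u x‖ ≤ ∑ i ∈ range n, (n : ℝ)⁻¹ * ‖u (x * v ^ i)‖ := by
      rw [orbitAvg, norm_smul, norm_inv, Real.norm_natCast, ← Finset.mul_sum]
      gcongr
      exact norm_sum_le _ _
    refine (Real.rpow_le_rpow (norm_nonneg _) h1 hq0).trans ?_
    refine Real.rpow_arith_mean_le_arith_mean_rpow _ _ _ (fun _ _ => by positivity) ?_
      (fun _ _ => norm_nonneg _) hq
    simp [hn'.ne']
  have hb' : ∀ i ∈ range n, IsBddFun fun x => (n : ℝ)⁻¹ * ‖u (x * v ^ i)‖ ^ q :=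
    fun i _ => (hb.comp (· * v ^ i)).const_mul _
  refine (hm.rightMean_mono (IsBddFun.norm_rpow hq0 fun x =>
    norm_orbitAvg_le v n u x hB fun _ _ => hu _) (IsBddFun.sum _ hb') hpt).trans ?_
  rw [hm.rightMean_sum _ hb', Finset.sum_congr rfl fun i _ => by
    rw [hm.rightMean_const_mul _ (hb.comp (· * v ^ i)), hm.rightMean_translate (v ^ i) hb]]
  simp [hn'.ne']

/-- Lazy orbit averaging decreases the `q`-energy by the amount given by uniform convexity. -/
theorem IsLeftInvariantMean.rightMean_lazy_orbitAvg_add_le (hm : IsLeftInvariantMean m) {q K : ℝ}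
    (hq : 1 ≤ q) (hK : 0 < K)
    (hX : ∀ x y : X, ‖x‖ ^ q + 1 / K ^ q * ‖y‖ ^ q ≤ (‖x + y‖ ^ q + ‖x - y‖ ^ q) / 2)
    (v : Γ) {n : ℕ} (hn : 0 < n) {u : Γ → X} {B : ℝ} (hu : ∀ x, ‖u x‖ ≤ B) :
    rightMean m (fun x => ‖(1 / 2 : ℝ) • (u x + orbitAvg v n u x)‖ ^ q) +
      ((2 * K) ^ q)⁻¹ * rightMean m (fun x => ‖u x - orbitAvg v n u x‖ ^ q) ≤
      rightMean m (fun x => ‖u x‖ ^ q) := by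
  have hq0 : 0 ≤ q := by linarith
  have hB : 0 ≤ B := (norm_nonneg _).trans (hu 1)
  have hA : ∀ x, ‖orbitAvg v n u x‖ ≤ B := fun x => norm_orbitAvg_le v n u x hB fun _ _ => hu _
  have hbu := IsBddFun.norm_rpow hq0 hu
  have hbA := IsBddFun.norm_rpow hq0 hA
  have hbs : IsBddFun fun x => ‖(1 / 2 : ℝ) • (u x + orbitAvg v n u x)‖ ^ q := by
    refine IsBddFun.norm_rpow (B := 1 / 2 * (B + B)) hq0 fun x => ?_
    rw [norm_smul, Real.norm_of_nonneg (by norm_num)]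
    gcongr
    exact (norm_add_le _ _).trans (add_le_add (hu x) (hA x))
  have hbd : IsBddFun fun x => ‖u x - orbitAvg v n u x‖ ^ q :=
    IsBddFun.norm_rpow (B := B + B) hq0 fun x =>
      (norm_sub_le _ _).trans (add_le_add (hu x) (hA x))
  have hpt : ∀ x, ‖(1 / 2 : ℝ) • (u x + orbitAvg v n u x)‖ ^ q +
      ((2 * K) ^ q)⁻¹ * ‖u x - orbitAvg v n u x‖ ^ q ≤
      1 / 2 * ‖u x‖ ^ q + 1 / 2 * ‖orbitAvg v n u x‖ ^ q := fun x => by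
    -- Convexity is applied to the half sum and half difference; the factor `1 / 2` in the latter
    -- turns `K` into `2 * K`.
    have h := hX ((1 / 2 : ℝ) • (u x + orbitAvg v n u x)) ((1 / 2 : ℝ) • (u x - orbitAvg v n u x))
    have e1 : (1 / 2 : ℝ) • (u x + orbitAvg v n u x) + (1 / 2 : ℝ) • (u x - orbitAvg v n u x) =
      u x := by module
    have e2 : (1 / 2 : ℝ) • (u x + orbitAvg v n u x) - (1 / 2 : ℝ) • (u x - orbitAvg v n u x) =
      orbitAvg v n u x := by module
    have e3 : 1 / K ^ q * ‖(1 / 2 : ℝ) • (u x - orbitAvg v n u x)‖ ^ q =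
        ((2 * K) ^ q)⁻¹ * ‖u x - orbitAvg v n u x‖ ^ q := by
      rw [norm_smul, Real.norm_of_nonneg (by norm_num), Real.mul_rpow (by norm_num) (norm_nonneg _),
        Real.mul_rpow (by norm_num) hK.le, one_div, one_div, Real.inv_rpow (by norm_num), mul_inv]
      ring
    rw [e1, e2, e3] at h
    linarith
  have h := hm.rightMean_mono (hbs.add (hbd.const_mul _))
    ((hbu.const_mul _).add (hbA.const_mul _)) hpt
  rw [hm.rightMean_add hbs (hbd.const_mul _), hm.rightMean_const_mul _ hbd,
    hm.rightMean_add (hbu.const_mul _) (hbA.const_mul _), hm.rightMean_const_mul _ hbu,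
    hm.rightMean_const_mul _ hbA] at h
  linarith [hm.rightMean_norm_orbitAvg_rpow_le hq v hn hu]

/-- Some scale carries only a small part of the energy. -/
theorem IsLeftInvariantMean.exists_scale_energy_le (hm : IsLeftInvariantMean m) {q K : ℝ}
    (hq : 1 ≤ q) (hK : 0 < K)
    (hX : ∀ x y : X, ‖x‖ ^ q + 1 / K ^ q * ‖y‖ ^ q ≤ (‖x + y‖ ^ q + ‖x - y‖ ^ q) / 2)
    {v : Γ} (hv : v ∈ Subgroup.center Γ) {N : ℕ → ℕ} (hN : ∀ j, 0 < N j) (A : Finset Γ)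
    {f : Γ → X} (hf : ∀ a ∈ A, ∀ x, ‖rightIncr a f x‖ ≤ 1) {J : ℕ} (hJ : 0 < J) :
    ∃ j < J, ∀ a ∈ A, rightMean m (fun x => ‖rightIncr a (fun y => smoothing v N f j y -
      orbitAvg v (N (j + 1)) (smoothing v N f j) y) x‖ ^ q) ≤ (2 * K) ^ q * (#A / J) := by
  have hq0 : 0 ≤ q := by linarith
  let D : ℕ → Γ → ℝ := fun j a => rightMean m (fun x => ‖rightIncr a (fun y => smoothing v N f j y -
      orbitAvg v (N (j + 1)) (smoothing v N f j) y) x‖ ^ q)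
  let E : ℕ → Γ → ℝ := fun j a => rightMean m (fun x => ‖rightIncr a (smoothing v N f j) x‖ ^ q)
  have hlip : ∀ j, ∀ a ∈ A, ∀ x, ‖rightIncr a (smoothing v N f j) x‖ ≤ 1 := fun j a ha x =>
    norm_rightIncr_smoothing_le hv N (hf a ha) j x
  have hDeq : ∀ j a, (fun x => ‖rightIncr a (fun y => smoothing v N f j y -
      orbitAvg v (N (j + 1)) (smoothing v N f j) y) x‖ ^ q) = fun x =>
      ‖rightIncr a (smoothing v N f j) x -
        orbitAvg v (N (j + 1)) (rightIncr a (smoothing v N f j)) x‖ ^ q := fun j a => by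
    funext x
    rw [← rightIncr_orbitAvg hv]
    simp only [rightIncr]
    congr 2
    abel
  have hstep : ∀ j, ∀ a ∈ A, ((2 * K) ^ q)⁻¹ * D j a ≤ E j a - E (j + 1) a := fun j a ha => by
    have h := hm.rightMean_lazy_orbitAvg_add_le hq hK hX v (hN (j + 1)) (hlip j a ha)
    simp only [D, E, hDeq, rightIncr_smoothing_succ hv]
    linarith
  have hD0 : ∀ j, ∀ a ∈ A, 0 ≤ D j a := fun j a ha => by
    simp only [D, hDeq]
    refine hm.rightMean_nonneg (IsBddFun.norm_rpow (B := 1 + 1) hq0 fun x => ?_)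
      fun x => by positivity
    exact (norm_sub_le _ _).trans (add_le_add (hlip j a ha x)
      (norm_orbitAvg_le _ _ _ _ zero_le_one fun _ _ => hlip j a ha _))
  have hE0 : ∀ j, ∀ a ∈ A, 0 ≤ E j a := fun j a ha =>
    hm.rightMean_nonneg (IsBddFun.norm_rpow hq0 (hlip j a ha)) fun x => by positivity
  have hE1 : ∀ j, ∀ a ∈ A, E j a ≤ 1 := fun j a ha => by
    have := hm.rightMean_mono (IsBddFun.norm_rpow hq0 (hlip j a ha)) (IsBddFun.const 1)
      fun x => Real.rpow_le_one (norm_nonneg _) (hlip j a ha x) hq0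
    rwa [hm.rightMean_const] at this
  -- The energies telescope over the scales. Summing over `A` too, at the price of the factor `#A`,
  -- gives one scale that serves all generators.
  have hsum : ∑ j ∈ range J, ∑ a ∈ A, ((2 * K) ^ q)⁻¹ * D j a ≤ ∑ j ∈ range J, (#A / J : ℝ) := by
    have hJ' : (J : ℝ) ≠ 0 := by exact_mod_cast hJ.ne'
    calc _ ≤ ∑ j ∈ range J, ∑ a ∈ A, (E j a - E (j + 1) a) :=
          Finset.sum_le_sum fun j _ => Finset.sum_le_sum fun a ha => hstep j a ha
      _ = ∑ a ∈ A, (E 0 a - E J a) := by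
          rw [Finset.sum_comm]
          exact Finset.sum_congr rfl fun a _ => Finset.sum_range_sub' (fun j => E j a) J
      _ ≤ ∑ a ∈ A, (1 : ℝ) :=
          Finset.sum_le_sum fun a ha => by linarith [hE1 0 a ha, hE0 J a ha]
      _ = _ := by simp [mul_div_cancel₀ _ hJ']
  obtain ⟨j, hj, hle⟩ := Finset.exists_le_of_sum_le (by simpa using hJ.ne') hsum
  refine ⟨j, by simpa using hj, fun a ha => ?_⟩
  have hKq : 0 < (2 * K) ^ q := by positivity
  have h1 : ((2 * K) ^ q)⁻¹ * D j a ≤ #A / J :=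
    (Finset.single_le_sum (f := fun a => ((2 * K) ^ q)⁻¹ * D j a)
      (fun b hb => mul_nonneg (by positivity) (hD0 j b hb)) ha).trans hle
  rwa [inv_mul_le_iff₀ hKq] at h1

end Energy

/-! ### Words, Lipschitz maps and compression -/

section Word

variable {Γ : Type*} [Group Γ]

theorem exists_word_of_closure_eq_top {S : Set Γ} (hS : Subgroup.closure S = ⊤) (g : Γ) :
    ∃ l : List Γ, l.length = wordLength S g ∧ (∀ a ∈ l, a ∈ S ∨ a⁻¹ ∈ S) ∧ l.prod = g := by
  have hne : {n : ℕ | ∃ l : List Γ, l.length = n ∧ (∀ a ∈ l, a ∈ S ∨ a⁻¹ ∈ S) ∧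
      l.prod = g}.Nonempty := by
    have hg : g ∈ Submonoid.closure (S ∪ S⁻¹) := by
      rw [← Subgroup.closure_toSubmonoid, hS]
      trivial
    obtain ⟨l, hl, hlg⟩ := Submonoid.exists_list_of_mem_closure hg
    exact ⟨_, l, rfl, fun a ha => by simpa using hl a ha, hlg⟩
  exact Nat.sInf_mem hne

theorem wordLength_le_one {S : Set Γ} {a : Γ} (ha : a ∈ S ∨ a⁻¹ ∈ S) : wordLength S a ≤ 1 :=
  Nat.sInf_le ⟨[a], by simp, by simpa using ha, by simp⟩

theorem wordDist_mul_right_self (S : Set Γ) (x g : Γ) :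
    wordDist S x (x * g) = wordLength S g := by
  simp [wordDist]

theorem norm_rightIncr_le_of_lipschitz {X : Type*} [NormedAddCommGroup X] {S : Set Γ} {f : Γ → X}
    (hf : ∀ x y, ‖f x - f y‖ ≤ wordDist S x y) (g x : Γ) :
    ‖rightIncr g f x‖ ≤ wordDist S g 1 := by
  simpa [wordDist, rightIncr] using hf (x * g) x

end Word

theorem compressionFunction_le {M X : Type*} [NormedAddCommGroup X] {d : M → M → ℝ} {f : M → X}
    {s R : ℝ} (h : ∀ ω, IsCompressionBound d f ω → ω s ≤ R) : compressionFunction d f s ≤ R := by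
  refine csSup_le ⟨0, fun _ => 0,
    ⟨fun _ _ _ _ _ => le_rfl, fun _ _ => le_rfl, fun _ _ _ => norm_nonneg _⟩, rfl⟩ ?_
  rintro r ⟨ω, hω, rfl⟩
  exact h ω hω

/-! ### The uniform convexity constant -/

section UniformConvexity

variable {q : ℝ} {X : Type*} [NormedAddCommGroup X]

theorem mem_uniformConvexityConstants_iff (hq : 0 < q) {K : ℝ} :
    K ∈ uniformConvexityConstants q X ↔ 0 < K ∧ ∀ x y : X,
      ‖x‖ ^ q + 1 / K ^ q * ‖y‖ ^ q ≤ (‖x + y‖ ^ q + ‖x - y‖ ^ q) / 2 := by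
  refine and_congr_right fun hK => forall₂_congr fun x y => ?_
  exact Real.rpow_le_rpow_iff (by positivity) (by positivity) (by positivity)

theorem one_le_of_mem_uniformConvexityConstants [Nontrivial X] (hq : 0 < q) {K : ℝ}
    (hK : K ∈ uniformConvexityConstants q X) : 1 ≤ K := by
  obtain ⟨hK0, h⟩ := (mem_uniformConvexityConstants_iff hq).1 hK
  obtain ⟨y, hy⟩ := exists_ne (0 : X)
  have hy' : 0 < ‖y‖ ^ q := Real.rpow_pos_of_pos (norm_pos_iff.2 hy) q
  have h1 := h 0 y
  rw [norm_zero, Real.zero_rpow hq.ne', zero_add, zero_add, zero_sub, norm_neg, add_self_div_two]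
    at h1
  have h2 : 1 / K ^ q ≤ 1 := by
    by_contra! hc
    nlinarith
  rw [div_le_one (by positivity)] at h2
  by_contra! hc
  exact absurd (Real.rpow_lt_one hK0.le hc hq) (not_lt.2 h2)

theorem one_le_uniformConvexityConst [Nontrivial X] (h : IsQUniformlyConvex q X) :
    1 ≤ uniformConvexityConst q X :=
  le_csInf h.2 fun _ hK => one_le_of_mem_uniformConvexityConstants (by linarith [h.1]) hK

/-- On a nontrivial space the infimum defining the uniform convexity constant is attained. -/
theorem uniformConvexityConst_mem [Nontrivial X] (h : IsQUniformlyConvex q X) :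
    uniformConvexityConst q X ∈ uniformConvexityConstants q X := by
  have hq : 0 < q := by linarith [h.1]
  have h1 := one_le_uniformConvexityConst h
  refine (mem_uniformConvexityConstants_iff hq).2 ⟨by linarith, fun x y => ?_⟩
  set R := (‖x + y‖ ^ q + ‖x - y‖ ^ q) / 2 - ‖x‖ ^ q with hR
  have key : ∀ K : ℝ, 0 < K → (‖x‖ ^ q + 1 / K ^ q * ‖y‖ ^ q ≤ (‖x + y‖ ^ q + ‖x - y‖ ^ q) / 2 ↔
      ‖y‖ ^ q ≤ R * K ^ q) := fun K hK => by
    rw [← div_le_iff₀ (by positivity : 0 < K ^ q), one_div_mul_eq_div, hR, le_sub_iff_add_le']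
  -- With `K ^ q` multiplied out the condition is closed in `K` on the whole line, so it passes to
  -- the infimum.
  have hclosed : IsClosed {K : ℝ | ‖y‖ ^ q ≤ R * K ^ q} :=
    isClosed_le continuous_const
      (continuous_const.mul (continuous_id.rpow_const fun _ => Or.inr hq.le))
  have hsub : uniformConvexityConstants q X ⊆ {K : ℝ | ‖y‖ ^ q ≤ R * K ^ q} := fun K hK => by
    obtain ⟨hK0, hK⟩ := (mem_uniformConvexityConstants_iff hq).1 hK
    exact (key K hK0).1 (hK x y)
  have hmem := hclosed.closure_subset_iff.2 hsub
    (csInf_mem_closure h.2 ⟨0, fun K hK => hK.1.le⟩)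
  exact (key _ (by linarith)).2 hmem

end UniformConvexity

/-! ### A compressed scale -/

section Scales

variable {Γ X : Type*} [Group Γ] [NormedAddCommGroup X] [NormedSpace ℝ X] {m : (Γ → ℝ) → ℝ}

/-- Along powers of a distorted central element, some scale is strongly compressed by `f`. -/
theorem IsLeftInvariantMean.exists_scale_compressed (hm : IsLeftInvariantMean m) {q K : ℝ}
    (hq : 1 ≤ q) (hK : 0 < K)
    (hX : ∀ x y : X, ‖x‖ ^ q + 1 / K ^ q * ‖y‖ ^ q ≤ (‖x + y‖ ^ q + ‖x - y‖ ^ q) / 2)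
    {v : Γ} (hv : v ∈ Subgroup.center Γ) (A : Finset Γ)
    {f : Γ → X} (hf : ∀ a ∈ A, ∀ x, ‖rightIncr a f x‖ ≤ 1) {c ρ : ℝ} (hc : 0 ≤ c) (hρ : 0 < ρ)
    (hpow : ∀ (k : ℕ) (x : Γ), ‖rightIncr (v ^ k) f x‖ ≤ c * (k : ℝ) ^ (1 / ρ))
    {B a J : ℕ} (hB : 0 < B) (ha : 0 < a) (ha2 : 2 ≤ ((a : ℝ) ^ 2) ^ (1 / ρ)) (hJ : 0 < J) {ε : ℝ}
    (h1 : (a : ℝ) ^ (-(1 / ρ)) ≤ ε) (h2 : (a : ℝ) ^ (1 / ρ - 1) ≤ ε) :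
    ∃ j < J, ∀ l : List Γ, (∀ s ∈ l, s ∈ A) → l.prod = (v ^ (B * a ^ (2 * j + 1)))⁻¹ →
      ∀ r : ℝ, (∀ x, r ≤ ‖rightIncr l.prod f x‖) →
        r ≤ 3 * c * ((B * a ^ (2 * j + 1) : ℕ) : ℝ) ^ (1 / ρ) * ε +
          l.length * (2 * K * (#A / J : ℝ) ^ (1 / q)) := by
  have hq0 : 0 < q := by linarith
  have ha' : (0 : ℝ) < a := by exact_mod_cast ha
  have hB' : (0 : ℝ) < B := by exact_mod_cast hB
  let N : ℕ → ℕ := fun j => B * a ^ (2 * j)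
  have hN : ∀ j, 0 < N j := fun j => by positivity
  have hNs : ∀ j, (N (j + 1) : ℝ) = (a : ℝ) ^ 2 * N j := fun j => by simp only [N]; push_cast; ring
  let δ : ℕ → ℝ := fun j => c * (N j : ℝ) ^ (1 / ρ)
  have hδ : ∀ j, 2 * δ j ≤ δ (j + 1) := fun j => by
    simp only [δ]
    rw [hNs, Real.mul_rpow (by positivity) (by positivity)]
    have : 0 ≤ c * (N j : ℝ) ^ (1 / ρ) := by positivity
    nlinarith
  have hfδ : ∀ j, ∀ i < N j, ∀ x, ‖rightIncr (v ^ i) f x‖ ≤ δ j := fun j i hi x => by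
    refine (hpow i x).trans ?_
    simp only [δ]
    gcongr
  obtain ⟨j, hj, hE⟩ := hm.exists_scale_energy_le hq hK hX hv hN A hf hJ
  refine ⟨j, hj, fun l hl hlp r hr => ?_⟩
  -- The geometric mean of `N j` and `N (j + 1)`: relative to `k ^ (1 / ρ)`, the distance from `f`
  -- to `g` gains `a ^ (-(1 / ρ))` and the motion of `h` gains `a ^ (1 / ρ - 1)`.
  set k : ℕ := B * a ^ (2 * j + 1) with hk
  set g := smoothing v N f j with hg
  set h := orbitAvg v (N (j + 1)) g with hh
  have hk0 : (0 : ℝ) < k := by exact_mod_cast (by positivity : 0 < k)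
  have e1 : (N j : ℝ) ^ (1 / ρ) = (k : ℝ) ^ (1 / ρ) * (a : ℝ) ^ (-(1 / ρ)) := by
    have : (k : ℝ) = N j * a := by simp only [N, hk]; push_cast; ring
    rw [this, Real.mul_rpow (by positivity) ha'.le, mul_assoc, ← Real.rpow_add ha']
    simp
  have e2 : k * (c * (N (j + 1) : ℝ) ^ (1 / ρ) / N (j + 1)) =
      c * (k : ℝ) ^ (1 / ρ) * (a : ℝ) ^ (1 / ρ - 1) := by
    have : (N (j + 1) : ℝ) = k * a := by simp only [N, hk]; push_cast; ring
    rw [this, Real.mul_rpow hk0.le ha'.le, Real.rpow_sub_one ha'.ne']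
    field_simp
  have hfg : ∀ x, ‖g x - f x‖ ≤ δ j := norm_smoothing_sub_le hv hN
    (fun j => by simp only [δ]; positivity) hδ hfδ j
  have hslow : ∀ x, ‖rightIncr l.prod h x‖ ≤ k * (c * (N (j + 1) : ℝ) ^ (1 / ρ) / N (j + 1)) :=
      fun x => by
    have := norm_rightIncr_pow_orbitAvg_le (F := g)
      (norm_rightIncr_smoothing_le hv N (hpow (N (j + 1))) j) k (x * (v ^ k)⁻¹)
    rw [hlp, rightIncr, norm_sub_rev]
    simpa [rightIncr, hh] using this
  -- The `3` counts the distance from `g` to `f` at both endpoints and the motion of `h`.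
  have hpt : ∀ x, r - 3 * c * (k : ℝ) ^ (1 / ρ) * ε ≤
      ‖rightIncr l.prod (fun y => g y - h y) x‖ := fun x => by
    have hdec : rightIncr l.prod f x = rightIncr l.prod (fun y => g y - h y) x +
        rightIncr l.prod h x - (g (x * l.prod) - f (x * l.prod)) + (g x - f x) := by
      simp only [rightIncr]
      abel
    have t1 := norm_add_le (rightIncr l.prod (fun y => g y - h y) x +
        rightIncr l.prod h x - (g (x * l.prod) - f (x * l.prod))) (g x - f x)
    have t2 := norm_sub_le (rightIncr l.prod (fun y => g y - h y) x +
        rightIncr l.prod h x) (g (x * l.prod) - f (x * l.prod))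
    have t3 := norm_add_le (rightIncr l.prod (fun y => g y - h y) x) (rightIncr l.prod h x)
    have t4 := hr x
    have t5 := hslow x
    have t6 := hfg x
    have t7 := hfg (x * l.prod)
    rw [hdec] at t4
    rw [e2] at t5
    simp only [δ, e1] at t6 t7
    have hck : 0 ≤ c * (k : ℝ) ^ (1 / ρ) := by positivity
    have t8 := mul_le_mul_of_nonneg_left h1 hck
    have t9 := mul_le_mul_of_nonneg_left h2 hck
    linarith
  by_cases hneg : r - 3 * c * (k : ℝ) ^ (1 / ρ) * ε ≤ 0
  · have : 0 ≤ l.length * (2 * K * (#A / J : ℝ) ^ (1 / q)) := by positivity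
    linarith
  push Not at hneg
  have hbd : ∀ a ∈ (A : Set Γ), ∃ B, ∀ x, ‖rightIncr a (fun y => g y - h y) x‖ ≤ B := by
    refine fun a ha => ⟨1 + 1, fun x => ?_⟩
    have hga := norm_rightIncr_smoothing_le hv N (hf a ha) j
    have e : rightIncr a (fun y => g y - h y) x = rightIncr a g x - rightIncr a h x := by
      simp only [rightIncr]; abel
    rw [e, hh, rightIncr_orbitAvg hv]
    exact (norm_sub_le _ _).trans (add_le_add (hga x)
      (norm_orbitAvg_le _ _ _ _ zero_le_one fun _ _ => hga _))
  have hfin := hm.rightMean_norm_rightIncr_prod_rpow_le hq hbd hE l hl hneg.le hpt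
  have hroot : ((l.length : ℝ) ^ q * ((2 * K) ^ q * (#A / J))) =
      (l.length * (2 * K * (#A / J : ℝ) ^ (1 / q))) ^ q := by
    rw [Real.mul_rpow (Nat.cast_nonneg _) (by positivity),
      Real.mul_rpow (by positivity : 0 ≤ 2 * K) (by positivity), ← Real.rpow_mul (by positivity),
      one_div_mul_cancel hq0.ne', Real.rpow_one]
  rw [hroot, Real.rpow_le_rpow_iff hneg.le (by positivity) hq0] at hfin
  linarith

end Scales

/-! ### Choice of scales -/

section Parameters

open Filter

/-- Choice of the scales: `B` is the initial one, `a ^ 2` the ratio and `J` the number of scales. -/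
theorem exists_scale_parameters {ρ c₁ c₂ : ℝ} (hρ : 1 < ρ) (h₁ : 0 < c₁) (h₂ : 0 < c₂) :
    ∃ t₀ : ℝ, 3 ≤ t₀ ∧ ∃ M : ℝ, 0 < M ∧ ∀ t ≥ t₀,
      ∃ B a J : ℕ, 0 < B ∧ 0 < a ∧ 0 < J ∧ 2 ≤ ((a : ℝ) ^ 2) ^ (1 / ρ) ∧
        t ≤ c₁ * (B : ℝ) ^ (1 / ρ) ∧ c₂ * ((B * a ^ (2 * J) : ℕ) : ℝ) ^ (1 / ρ) ≤ t ^ 2 ∧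
        (a : ℝ) ^ (-(1 / ρ)) ≤ (Real.log (Real.log t) / Real.log t) ^ (1 / 2 : ℝ) ∧
        (a : ℝ) ^ (1 / ρ - 1) ≤ (Real.log (Real.log t) / Real.log t) ^ (1 / 2 : ℝ) ∧
        1 / (J : ℝ) ≤ M * (Real.log (Real.log t) / Real.log t) := by
  have hρ0 : 0 < ρ := by linarith
  have hθ' : 0 < 1 - 1 / ρ := by
    rw [sub_pos, div_lt_one hρ0]; exact hρ
  -- This `p` makes both exponents of `a = b ^ p` in the error terms at most `-1 / 2` in `b`.
  obtain ⟨p, hp⟩ := exists_nat_ge (max (ρ / 2) (1 / (2 * (1 - 1 / ρ))))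
  have hp1 : 1 / 2 ≤ p * (1 / ρ) := by
    have := (le_max_left _ _).trans hp
    rw [mul_one_div, le_div_iff₀ hρ0]
    linarith
  have hp2 : 1 / 2 ≤ p * (1 - 1 / ρ) := by
    have := (le_max_right _ _).trans hp
    rw [div_le_iff₀ (by positivity)] at this
    linarith
  have hp0 : (0 : ℝ) < p := by
    have := (le_max_left _ _).trans hp
    linarith
  have hlog := Real.tendsto_log_atTop
  have hev1 : ∀ᶠ t : ℝ in atTop, 1 ≤ Real.log (Real.log t) :=
    (hlog.comp hlog).eventually_ge_atTop 1
  have hev2 : ∀ᶠ t : ℝ in atTop, 8 * p * Real.log (Real.log t) ≤ ρ * Real.log t := by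
    have h := (Real.isLittleO_log_id_atTop.bound (c := ρ / (8 * p)) (by positivity))
    filter_upwards [hlog.eventually h, hlog.eventually_ge_atTop 0] with t ht ht0
    rw [id, Real.norm_of_nonneg ht0, Real.norm_eq_abs] at ht
    have := (le_abs_self _).trans ht
    rw [div_mul_eq_mul_div, le_div_iff₀ (by positivity)] at this
    linarith
  -- Of `t ^ (2 * ρ)`, the factor `t ^ ρ` goes to `B` and `t ^ (ρ / 2)` to `a ^ (2 * J)`; the
  -- remaining `t ^ (ρ / 2)` absorbs the constants.
  have hev3 : ∀ᶠ t : ℝ in atTop, (c₁⁻¹ ^ ρ + 1) * c₂ ^ ρ ≤ t ^ (ρ / 2) :=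
    (tendsto_rpow_atTop (by positivity)).eventually_ge_atTop _
  obtain ⟨t₁, ht₁⟩ := eventually_atTop.1 (hev1.and (hev2.and hev3))
  refine ⟨max t₁ 3, le_max_right _ _, 16 * p / ρ, by positivity, fun t ht => ?_⟩
  obtain ⟨hl1, hl2, hl3⟩ := ht₁ t ((le_max_left _ _).trans ht)
  have ht3 : 3 ≤ t := (le_max_right _ _).trans ht
  have ht0 : 0 < t := by linarith
  set s := Real.log t with hs
  have hs0 : 0 < s := Real.log_pos (by linarith)
  have hs2 : 2 ≤ s := by
    have := Real.log_le_sub_one_of_pos hs0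
    linarith
  set σ := Real.log s with hσ
  let b : ℕ := ⌈s⌉₊ + 1
  have hb1 : s ≤ b := by
    have := Nat.le_ceil s
    simp only [b]; push_cast; linarith
  have hb2 : (2 : ℝ) ≤ b := hs2.trans hb1
  have hb3 : (b : ℝ) ≤ s ^ 2 := by
    have := (Nat.ceil_lt_add_one hs0.le).le
    simp only [b]; push_cast; nlinarith
  have hb0 : (0 : ℝ) < b := by linarith
  have hpowb : ∀ θ : ℝ, ((b ^ p : ℕ) : ℝ) ^ θ = (b : ℝ) ^ (p * θ) := fun θ => by
    push_cast
    rw [Real.rpow_mul hb0.le, Real.rpow_natCast]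
  have hsmall : ∀ θ : ℝ, 1 / 2 ≤ p * θ → ((b ^ p : ℕ) : ℝ) ^ (-θ) ≤ (σ / s) ^ (1 / 2 : ℝ) :=
      fun θ hθ => by
    rw [hpowb]
    calc (b : ℝ) ^ (p * -θ) ≤ (b : ℝ) ^ (-(1 / 2) : ℝ) :=
          Real.rpow_le_rpow_of_exponent_le (by linarith) (by linarith)
      _ ≤ s ^ (-(1 / 2) : ℝ) := Real.rpow_le_rpow_of_nonpos hs0 hb1 (by norm_num)
      _ = (1 / s) ^ (1 / 2 : ℝ) := by
          rw [one_div s, Real.inv_rpow hs0.le, Real.rpow_neg hs0.le]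
      _ ≤ _ := by gcongr
  -- The largest number of scales for which `b ≤ s ^ 2` still yields `a ^ (2 * J) ≤ exp (4 * p * J *
  -- σ) ≤ t ^ (ρ / 2)`.
  set x := ρ * s / (8 * p * σ) with hx
  have hσ0 : 0 < σ := by linarith
  have hx1 : 1 ≤ x := by rw [hx, one_le_div (by positivity)]; exact hl2
  have hJ1 : 0 < ⌊x⌋₊ := Nat.floor_pos.2 hx1
  have hJle : (⌊x⌋₊ : ℝ) ≤ x := Nat.floor_le (by linarith)
  have hJge : x / 2 ≤ ⌊x⌋₊ := by
    have h := (Nat.lt_floor_add_one x).le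
    have h' : (1 : ℝ) ≤ ⌊x⌋₊ := by exact_mod_cast hJ1
    linarith
  have hBpos : 0 < (t / c₁) ^ ρ := by positivity
  refine ⟨⌈(t / c₁) ^ ρ⌉₊, b ^ p, ⌊x⌋₊, Nat.ceil_pos.2 hBpos, by positivity, hJ1, ?_, ?_, ?_,
    hsmall _ hp1, ?_, ?_⟩
  · rw [← Real.rpow_natCast, ← Real.rpow_mul (by positivity), hpowb]
    refine hb2.trans ?_
    conv_lhs => rw [← Real.rpow_one (b : ℝ)]
    refine Real.rpow_le_rpow_of_exponent_le (by linarith) ?_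
    push_cast
    linarith
  · have : t / c₁ ≤ (⌈(t / c₁) ^ ρ⌉₊ : ℝ) ^ (1 / ρ) := by
      calc t / c₁ = ((t / c₁) ^ ρ) ^ (1 / ρ) := by
            rw [← Real.rpow_mul (by positivity), mul_one_div_cancel hρ0.ne', Real.rpow_one]
        _ ≤ _ := by gcongr; exact Nat.le_ceil _
    rwa [div_le_iff₀' h₁] at this
  · have hBle : (⌈(t / c₁) ^ ρ⌉₊ : ℝ) ≤ (c₁⁻¹ ^ ρ + 1) * t ^ ρ := by
      have h := (Nat.ceil_lt_add_one hBpos.le).le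
      have h' : 1 ≤ t ^ ρ := Real.one_le_rpow (by linarith) hρ0.le
      have h'' : (t / c₁) ^ ρ = c₁⁻¹ ^ ρ * t ^ ρ := by
        rw [div_eq_inv_mul, Real.mul_rpow (by positivity) ht0.le]
      linarith
    have hale : (((b ^ p) ^ (2 * ⌊x⌋₊) : ℕ) : ℝ) ≤ t ^ (ρ / 2) := by
      have e : ((b ^ p) ^ (2 * ⌊x⌋₊) : ℕ) = b ^ (2 * p * ⌊x⌋₊) := by
        rw [← pow_mul]; ring_nf
      rw [e]
      push_cast
      calc (b : ℝ) ^ (2 * p * ⌊x⌋₊) ≤ (s ^ 2) ^ (2 * p * ⌊x⌋₊) := by gcongr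
        _ = Real.exp (σ * (4 * p * ⌊x⌋₊)) := by
            rw [← pow_mul, ← Real.rpow_natCast, Real.rpow_def_of_pos hs0, ← hσ]
            push_cast; ring_nf
        _ ≤ Real.exp (s * (ρ / 2)) := by
            refine Real.exp_le_exp.2 ?_
            calc σ * (4 * p * ⌊x⌋₊) ≤ σ * (4 * p * x) := by gcongr
              _ = s * (ρ / 2) := by rw [hx]; field_simp; norm_num
        _ = t ^ (ρ / 2) := by rw [Real.rpow_def_of_pos ht0]
    have hprod : ((⌈(t / c₁) ^ ρ⌉₊ * (b ^ p) ^ (2 * ⌊x⌋₊) : ℕ) : ℝ) ≤ (t ^ 2 / c₂) ^ ρ := by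
      rw [Nat.cast_mul]
      have hc2 : 0 < c₂ ^ ρ := by positivity
      calc _ ≤ (c₁⁻¹ ^ ρ + 1) * t ^ ρ * t ^ (ρ / 2) := by gcongr
        _ ≤ (t ^ (ρ / 2) / c₂ ^ ρ) * t ^ ρ * t ^ (ρ / 2) := by
            gcongr
            rwa [le_div_iff₀ hc2]
        _ = (t ^ 2 / c₂) ^ ρ := by
            rw [Real.div_rpow (by positivity) h₂.le]
            have : (t ^ 2) ^ ρ = t ^ (ρ / 2) * t ^ ρ * t ^ (ρ / 2) := by
              rw [← Real.rpow_natCast, ← Real.rpow_mul ht0.le, ← Real.rpow_add ht0,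
                ← Real.rpow_add ht0]
              congr 1
              push_cast; ring
            rw [this]; ring
    calc c₂ * _ ≤ c₂ * ((t ^ 2 / c₂) ^ ρ) ^ (1 / ρ) := by gcongr
      _ = t ^ 2 := by
        rw [← Real.rpow_mul (by positivity), mul_one_div_cancel hρ0.ne', Real.rpow_one]
        field_simp
  · have := hsmall (1 - 1 / ρ) hp2
    rwa [neg_sub] at this
  · calc 1 / (⌊x⌋₊ : ℝ) ≤ 1 / (x / 2) := by gcongr
      _ = 16 * p / ρ * (σ / s) := by rw [hx]; field_simp; norm_num

end Parameters

/-! ### Comparison of logarithmic rates -/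

theorem log_log_div_log_pos {n : ℝ} (hn : 3 ≤ n) : 0 < Real.log (Real.log n) / Real.log n := by
  have h : 1 < Real.log n := by
    rw [Real.lt_log_iff_exp_lt (by linarith)]
    linarith [Real.exp_one_lt_d9]
  exact div_pos (Real.log_pos h) (by linarith)

theorem log_log_div_log_le_one {n : ℝ} (hn : 3 ≤ n) : Real.log (Real.log n) / Real.log n ≤ 1 := by
  have h : 0 < Real.log n := Real.log_pos (by linarith)
  rw [div_le_one h]
  linarith [Real.log_le_sub_one_of_pos h]

theorem log_log_div_log_le_two_mul {t n : ℝ} (ht : 3 ≤ t) (h1 : t ≤ n) (h2 : n ≤ t ^ 2) :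
    Real.log (Real.log t) / Real.log t ≤ 2 * (Real.log (Real.log n) / Real.log n) := by
  have ht0 : 0 < Real.log t := Real.log_pos (by linarith)
  have htn : Real.log t ≤ Real.log n := Real.log_le_log (by linarith) h1
  have hn0 : 0 < Real.log n := ht0.trans_le htn
  have hn2 : Real.log n ≤ 2 * Real.log t := by
    have := Real.log_le_log (by linarith) h2
    rwa [Real.log_pow, Nat.cast_ofNat] at this
  have hll : Real.log (Real.log t) ≤ Real.log (Real.log n) := Real.log_le_log ht0 htn
  have hpos : 0 < Real.log (Real.log n) := by
    have := log_log_div_log_pos (ht.trans h1)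
    exact (div_pos_iff_of_pos_right hn0).1 this
  rw [← mul_div_assoc, div_le_div_iff₀ ht0 hn0]
  nlinarith

/-- Replacing `b ^ (1 / q)` by `max 1 b` keeps the final constant independent of `q`. -/
theorem mul_rpow_one_div_le {b r q : ℝ} (hb : 0 ≤ b) (hr : 0 ≤ r) (hq : 1 ≤ q) :
    (b * r) ^ (1 / q) ≤ max 1 b * r ^ (1 / q) := by
  rw [Real.mul_rpow hb hr]
  gcongr
  have hq' : 1 / q ≤ 1 := by rw [div_le_one (by linarith)]; exact hq
  calc b ^ (1 / q) ≤ (max 1 b) ^ (1 / q) := by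
        gcongr
        exact le_max_right _ _
    _ ≤ (max 1 b) ^ (1 : ℝ) := Real.rpow_le_rpow_of_exponent_le (le_max_left _ _) hq'
    _ = max 1 b := Real.rpow_one _

/-! ### The main theorem -/

theorem mainTheorem12 {Γ : Type*} [Group Γ] (hΓ : IsAmenableGroup Γ)
    (S : Finset Γ) (hS : Subgroup.closure (S : Set Γ) = ⊤)
    (v : Γ) (hv : v ∈ Subgroup.center Γ) (ρ : ℝ) (hρ : 1 < ρ)
    (hvρ : ∃ c₁ c₂ : ℝ, 0 < c₁ ∧ 0 < c₂ ∧ ∀ k : ℕ, 1 ≤ k →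
      c₁ * (k : ℝ) ^ (1 / ρ) ≤ wordDist (S : Set Γ) (v ^ k) 1 ∧
      wordDist (S : Set Γ) (v ^ k) 1 ≤ c₂ * (k : ℝ) ^ (1 / ρ)) :
    ∃ C : ℝ, 0 < C ∧
      ∀ (q : ℝ) (X : Type*) [NormedAddCommGroup X] [NormedSpace ℝ X] [CompleteSpace X],
        IsQUniformlyConvex q X →
        ∀ f : Γ → X, (∀ x y : Γ, ‖f x - f y‖ ≤ wordDist (S : Set Γ) x y) →
        ∀ t : ℝ, 3 ≤ t → ∃ n : ℕ, t ≤ (n : ℝ) ∧ (n : ℝ) ≤ t ^ 2 ∧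
          compressionFunction (wordDist (S : Set Γ)) f (n : ℝ) / (n : ℝ) ≤
            C * (uniformConvexityConst q X *
              (Real.log (Real.log (n : ℝ)) / Real.log (n : ℝ)) ^ (1 / q)) := by
  classical
  obtain ⟨m, hm⟩ := hΓ
  obtain ⟨c₁, c₂, h₁, h₂, hd⟩ := hvρ
  have hρ0 : 0 < ρ := by linarith
  have hlen : ∀ k : ℕ, wordDist (S : Set Γ) (v ^ k) 1 = wordLength (S : Set Γ) (v ^ k)⁻¹ :=
    fun k => by simp [wordDist]
  obtain ⟨t₀, ht₀, M, hM, hpar⟩ := exists_scale_parameters hρ h₁ h₂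
  -- a power of `v` far enough away to control the bounded range of `t`
  obtain ⟨k₀, hk₀, hk₀'⟩ : ∃ k : ℕ, 1 ≤ k ∧ t₀ + 1 ≤ c₁ * (k : ℝ) ^ (1 / ρ) := by
    have h := ((tendsto_rpow_atTop (one_div_pos.2 hρ0)).comp
      tendsto_natCast_atTop_atTop).eventually_ge_atTop ((t₀ + 1) / c₁)
    obtain ⟨k, hk, hk1⟩ := (h.and (Filter.eventually_ge_atTop 1)).exists
    exact ⟨k, hk1, (div_le_iff₀' h₁).1 hk⟩
  set A : Finset Γ := S ∪ S.image (·⁻¹) with hA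
  have hAmem : ∀ a, a ∈ A ↔ a ∈ (S : Set Γ) ∨ a⁻¹ ∈ (S : Set Γ) := fun a => by
    simp [hA, inv_eq_iff_eq_inv]
  -- A lower bound for the rate on `3 ≤ n ≤ t₀ + 1`; the summand `L₀ / η` of the constant covers `t
  -- < t₀`.
  set η := Real.log (Real.log 3) / Real.log (t₀ + 1) with hη
  have hη0 : 0 < η := by
    have h3 := log_log_div_log_pos (n := 3) le_rfl
    have h3' : 0 < Real.log 3 := Real.log_pos (by norm_num)
    exact div_pos ((div_pos_iff_of_pos_right h3').1 h3) (Real.log_pos (by linarith))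
  set L₀ : ℝ := wordDist (S : Set Γ) (v ^ k₀) 1 with hL₀
  set P : ℝ := 3 * (c₂ / c₁) * max 1 2 + 2 * max 1 (#A * M * 2) with hP
  have hL₀0 : 0 ≤ L₀ := by rw [hL₀, wordDist]; positivity
  have hP0 : 0 < P := by positivity
  refine ⟨P + L₀ / η, by positivity, ?_⟩
  intro q X _ _ _ hX f hf t ht
  have hq2 : 2 ≤ q := hX.1
  have hq0 : 0 < q := by linarith
  have hpow0 : ∀ n : ℝ, 3 ≤ n → 0 ≤ (Real.log (Real.log n) / Real.log n) ^ (1 / q) :=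
    fun n hn => Real.rpow_nonneg (log_log_div_log_pos hn).le _
  have hceil : (⌈t⌉₊ : ℝ) ≤ t ^ 2 := by
    have := (Nat.ceil_lt_add_one (by linarith : 0 ≤ t)).le
    nlinarith
  have hlet : ∀ {l : List Γ}, (∀ a ∈ l, a ∈ (S : Set Γ) ∨ a⁻¹ ∈ (S : Set Γ)) → ∀ a ∈ l, a ∈ A :=
    fun h a ha => (hAmem a).2 (h a ha)
  -- On the zero space every positive constant is admissible, so `K` is `0` and the bound `1 ≤ K`
  -- fails; but `f` is constant and its compression function is at most `0`.
  rcases subsingleton_or_nontrivial X with hsub | hnt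
  · have hn : t ≤ (⌈t⌉₊ : ℝ) := Nat.le_ceil t
    refine ⟨⌈t⌉₊, hn, hceil, ?_⟩
    have hK : 0 ≤ uniformConvexityConst q X := Real.sInf_nonneg fun K hK => hK.1.le
    have hR := hpow0 _ (ht.trans hn)
    refine le_trans (div_nonpos_of_nonpos_of_nonneg ?_ (by positivity))
      (by positivity : 0 ≤ (P + L₀ / η) * (uniformConvexityConst q X *
        (Real.log (Real.log (⌈t⌉₊ : ℝ)) / Real.log (⌈t⌉₊ : ℝ)) ^ (1 / q)))
    refine compressionFunction_le fun ω hω => ?_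
    obtain ⟨k, hk1, hk⟩ : ∃ k : ℕ, 1 ≤ k ∧ (⌈t⌉₊ : ℝ) ≤ c₁ * (k : ℝ) ^ (1 / ρ) := by
      have h := ((tendsto_rpow_atTop (one_div_pos.2 hρ0)).comp
        tendsto_natCast_atTop_atTop).eventually_ge_atTop ((⌈t⌉₊ : ℝ) / c₁)
      obtain ⟨k, hk, hk1⟩ := (h.and (Filter.eventually_ge_atTop 1)).exists
      exact ⟨k, hk1, (div_le_iff₀' h₁).1 hk⟩
    have hnd := hk.trans (hd k hk1).1
    have hn0 : (0 : ℝ) < ⌈t⌉₊ := by linarith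
    have h1 := hω.monotoneOn hn0 (hn0.trans_le hnd) hnd
    have h2 := hω.le_norm _ _ (hn0.trans_le hnd)
    rw [Subsingleton.elim (f (v ^ k)) (f 1), sub_self, norm_zero] at h2
    exact h1.trans h2
  set K := uniformConvexityConst q X with hKdef
  have hK1 : 1 ≤ K := one_le_uniformConvexityConst hX
  obtain ⟨hK0, hKX⟩ := (mem_uniformConvexityConstants_iff hq0).1 (uniformConvexityConst_mem hX)
  rcases lt_or_ge t t₀ with hlt | hge
  · have hn : t ≤ (⌈t⌉₊ : ℝ) := Nat.le_ceil t
    refine ⟨⌈t⌉₊, hn, hceil, ?_⟩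
    set n : ℝ := (⌈t⌉₊ : ℝ) with hndef
    have hn3 : 3 ≤ n := ht.trans hn
    have hnt₀ : n ≤ t₀ + 1 := by
      have := (Nat.ceil_lt_add_one (by linarith : 0 ≤ t)).le
      linarith
    have hnd : n ≤ L₀ := hnt₀.trans (hk₀'.trans (hd k₀ hk₀).1)
    have hcomp : compressionFunction (wordDist (S : Set Γ)) f n ≤ L₀ :=
      compressionFunction_le fun ω hω => by
        have hn0 : 0 < n := by linarith
        have h1 := hω.monotoneOn hn0 (hn0.trans_le hnd) hnd
        exact h1.trans ((hω.le_norm _ _ (hn0.trans_le hnd)).trans (hf _ _))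
    have hr : η ≤ (Real.log (Real.log n) / Real.log n) ^ (1 / q) := by
      have hr0 := log_log_div_log_pos hn3
      have h3 : 0 < Real.log (Real.log 3) := by
        have h3' : 0 < Real.log 3 := Real.log_pos (by norm_num)
        exact (div_pos_iff_of_pos_right h3').1 (log_log_div_log_pos le_rfl)
      have hl3 : 0 < Real.log 3 := Real.log_pos (by norm_num)
      have hln : 0 < Real.log n := Real.log_pos (by linarith)
      have h1 : η ≤ Real.log (Real.log n) / Real.log n :=
        div_le_div₀ (Real.log_nonneg (by
            by_contra! hc
            have := Real.log_nonpos hln.le hc.le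
            exact absurd hr0 (not_lt.2 (div_nonpos_of_nonpos_of_nonneg this hln.le))))
          (Real.log_le_log hl3 (Real.log_le_log (by norm_num) hn3)) hln
          (Real.log_le_log (by linarith) hnt₀)
      refine h1.trans ?_
      conv_lhs => rw [← Real.rpow_one (Real.log (Real.log n) / Real.log n)]
      refine Real.rpow_le_rpow_of_exponent_ge hr0 (log_log_div_log_le_one hn3) ?_
      rw [div_le_one hq0]
      linarith
    calc compressionFunction (wordDist (S : Set Γ)) f n / n ≤ L₀ / n := by gcongr
      _ ≤ L₀ := div_le_self hL₀0 (by linarith)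
      _ = L₀ / η * (1 * η) := by field_simp
      _ ≤ (P + L₀ / η) * (K * (Real.log (Real.log n) / Real.log n) ^ (1 / q)) := by
        gcongr
        linarith
  · obtain ⟨B, a, J, hB, ha, hJ, ha2, htB, htJ, hε1, hε2, hJM⟩ := hpar t hge
    have hfA : ∀ a ∈ A, ∀ x, ‖rightIncr a f x‖ ≤ 1 := fun a ha x => by
      refine (norm_rightIncr_le_of_lipschitz hf a x).trans ?_
      have : wordLength (S : Set Γ) a⁻¹ ≤ 1 :=
        wordLength_le_one (by simpa using ((hAmem a).1 ha).symm)
      simpa [wordDist] using this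
    have hpow : ∀ (k : ℕ) (x : Γ), ‖rightIncr (v ^ k) f x‖ ≤ c₂ * (k : ℝ) ^ (1 / ρ) :=
        fun k x => by
      rcases Nat.eq_zero_or_pos k with rfl | hk
      · simp only [pow_zero, rightIncr, mul_one, sub_self, norm_zero]
        positivity
      · exact (norm_rightIncr_le_of_lipschitz hf _ x).trans (hd k hk).2
    obtain ⟨j, hj, hcompr⟩ := hm.exists_scale_compressed (by linarith) hK0 hKX hv A hfA h₂.le hρ0
      hpow hB ha ha2 hJ hε1 hε2
    set k : ℕ := B * a ^ (2 * j + 1) with hk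
    have hk1 : 1 ≤ k := Nat.succ_le_of_lt (by positivity)
    -- The inverse appears because `wordDist` from `v ^ k` to `1` is the word length of `(v ^ k)⁻¹`;
    -- the required `n` is exactly this length.
    obtain ⟨l, hll, hlS, hlp⟩ := exists_word_of_closure_eq_top hS (v ^ k)⁻¹
    have hn : (l.length : ℝ) = wordDist (S : Set Γ) (v ^ k) 1 := by rw [hll, hlen]
    obtain ⟨hlow, hup⟩ := hd k hk1
    rw [← hn] at hlow hup
    have hBk : (B : ℝ) ≤ k := by
      exact_mod_cast Nat.le_mul_of_pos_right B (by positivity)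
    have hkJ : (k : ℝ) ≤ ((B * a ^ (2 * J) : ℕ) : ℝ) := by
      refine Nat.cast_le.2 (Nat.mul_le_mul_left B (Nat.pow_le_pow_right ha (by omega)))
    have htn : t ≤ l.length := htB.trans (le_trans (by gcongr) hlow)
    have hnt : (l.length : ℝ) ≤ t ^ 2 := hup.trans (le_trans (by gcongr) htJ)
    refine ⟨l.length, htn, hnt, ?_⟩
    set n : ℝ := (l.length : ℝ) with hndef
    have hn3 : 3 ≤ n := ht.trans htn
    have hn0 : 0 < n := by linarith
    set r := Real.log (Real.log n) / Real.log n with hr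
    set r' := Real.log (Real.log t) / Real.log t with hr'
    have hr0 : 0 < r := log_log_div_log_pos hn3
    have hr'0 : 0 < r' := log_log_div_log_pos ht
    have hr'r : r' ≤ 2 * r := log_log_div_log_le_two_mul ht htn hnt
    -- Since `r' ≤ 1` and `q ≥ 2`, the exponent `1 / 2` suffices for every `q`, so the scales need
    -- not depend on `q`.
    have hε : r' ^ (1 / 2 : ℝ) ≤ max 1 2 * r ^ (1 / q) := by
      calc r' ^ (1 / 2 : ℝ) ≤ r' ^ (1 / q) := by
            refine Real.rpow_le_rpow_of_exponent_ge hr'0 (log_log_div_log_le_one ht) ?_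
            gcongr
        _ ≤ (2 * r) ^ (1 / q) := by gcongr
        _ ≤ _ := mul_rpow_one_div_le (by norm_num) hr0.le (by linarith)
    have hAJ : (#A / J : ℝ) ^ (1 / q) ≤ max 1 (#A * M * 2) * r ^ (1 / q) := by
      calc (#A / J : ℝ) ^ (1 / q) = (#A * (1 / J) : ℝ) ^ (1 / q) := by rw [mul_one_div]
        _ ≤ (#A * (M * (2 * r)) : ℝ) ^ (1 / q) := by
            gcongr
            exact hJM.trans (by gcongr)
        _ = (#A * M * 2 * r) ^ (1 / q) := by congr 1; ring
        _ ≤ _ := mul_rpow_one_div_le (by positivity) hr0.le (by linarith)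
    have hcomp : compressionFunction (wordDist (S : Set Γ)) f n ≤
        3 * c₂ * (k : ℝ) ^ (1 / ρ) * r' ^ (1 / 2 : ℝ) + n * (2 * K * (#A / J : ℝ) ^ (1 / q)) :=
      compressionFunction_le fun ω hω => by
        refine hcompr l (hlet hlS) hlp _ fun x => ?_
        have hdist : wordDist (S : Set Γ) x (x * l.prod) = n := by
          rw [wordDist_mul_right_self, hlp, ← hll]
        have := hω.le_norm x (x * l.prod) (by rw [hdist]; exact hn0)
        rwa [hdist, norm_sub_rev] at this
    have hkn : (k : ℝ) ^ (1 / ρ) ≤ n / c₁ := by rwa [le_div_iff₀' h₁]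
    calc compressionFunction (wordDist (S : Set Γ)) f n / n
        ≤ (3 * c₂ * (n / c₁) * (max 1 2 * r ^ (1 / q)) +
          n * (2 * K * (max 1 (#A * M * 2) * r ^ (1 / q)))) / n := by
          gcongr
          refine hcomp.trans ?_
          gcongr
      _ = 3 * (c₂ / c₁) * max 1 2 * (1 * r ^ (1 / q)) +
          2 * max 1 (#A * M * 2) * (K * r ^ (1 / q)) := by
          field_simp
      _ ≤ 3 * (c₂ / c₁) * max 1 2 * (K * r ^ (1 / q)) +
          2 * max 1 (#A * M * 2) * (K * r ^ (1 / q)) := by gcongr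
      _ = P * (K * r ^ (1 / q)) := by rw [hP]; ring
      _ ≤ (P + L₀ / η) * (K * r ^ (1 / q)) := by
          gcongr
          have : 0 ≤ L₀ / η := by positivity
          linarith
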